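/- Let $n\ge 2$ and $k\ge 1$ be integers. Let $\mathcal S_m$ be the set of permutations of size $m$ (so $|\mathcal S_0|=1$), let $n\cdots 1$ be the decreasing permutation of size $n$, and let $\mathrm{Av}_m(n\cdots 1)\subseteq\mathcal S_m$ be the set of permutations of size $m$ having no (not necessarily consecutive) occurrence of the pattern $n\cdots 1$, i.e. no decreasing subsequence of length $n$; put $\mathrm{Av}(n\cdots1)=\bigcup_{m\ge1}\mathrm{Av}_m(n\cdots1)$. For $\pi\in\mathcal S_k$ and a permutation $\sigma$ of size $|\sigma|\geq 1$, let $\widetilde{\text{c-occ}}(\pi,\sigma)$ be the number of intervals of $k$ consecutive positions of $\sigma$ whose entries are in the same relative order as $\pi$, divided by $|\sigma|$. Define $$P_k^{\mathrm{Av}(n\cdots 1)}=\Big\{\vec v\in[0,1]^{\mathcal S_k}\ \Big|\ \exists\,(\sigma^m)_{m\ge1}\text{ in }\mathrm{Av}(n\cdots 1)\text{ with }|\sigma^m|\to\infty\text{ and }\widetilde{\text{c-occ}}(\pi,\sigma^m)\to\vec v_\pi\ \ \forall\pi\in\mathcal S_k\Big\}.$$ Then $P_k^{\mathrm{Av}(n\cdots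 1)}$ is a nonempty convex subset of $\mathbb R^{\mathcal S_k}$, and its dimension, i.e. the dimension of its affine hull, is $$\dim P_k^{\mathrm{Av}(n\cdots 1)}=|\mathrm{Av}_k(n\cdots 1)|-|\mathrm{Av}_{k-1}(n\cdots 1)|.$$ -/

import Mathlib

open Filter Topology

namespace ConsecutivePatterns

/-- The set of all finite permutations: a size `n` together with a permutation of an `n`-element
chain (positions and values are numbered from `0`). -/
abbrev AnyPerm : Type := Σ n : ℕ, Equiv.Perm (Fin n)

/-- `std (σ (f 0), σ (f 1), …) = π`: the entries of `σ` at the positions `f 0, f 1, …` are in the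
same relative order as the entries of `π`. -/
def InducesPattern {k n : ℕ} (σ : Equiv.Perm (Fin n)) (f : Fin k → Fin n)
    (π : Equiv.Perm (Fin k)) : Prop :=
  ∀ a b : Fin k, π a < π b ↔ σ (f a) < σ (f b)

/-- `π` occurs in `σ` as a classical (not necessarily consecutive) pattern. An order embedding
`Fin k ↪o Fin n` is the increasing enumeration of a `k`-element set of positions. -/
def Contains {k n : ℕ} (σ : Equiv.Perm (Fin n)) (π : Equiv.Perm (Fin k)) : Prop :=
  ∃ f : Fin k ↪o Fin n, InducesPattern σ f π

/-- `Av_n(B)`: the permutations of size `n` that avoid every pattern of `B`. -/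
def Av (B : Set AnyPerm) (n : ℕ) : Set (Equiv.Perm (Fin n)) :=
  {σ | ∀ τ ∈ B, ¬ Contains σ τ.2}

/-- `Av(B)`: the `B`-avoiding permutations of arbitrary size at least one. -/
def AvClass (B : Set AnyPerm) : Set AnyPerm :=
  {σ | 1 ≤ σ.1 ∧ σ.2 ∈ Av B σ.1}

open Classical in
/-- The number of consecutive occurrences of `π` (of size `k`) in `σ` (of size `n`). The
intervals of `k` positions are the sets `{i, i + 1, …, i + k - 1}`, and they are counted by their
first position `i`. -/
noncomputable def consecutiveOcc {k n : ℕ} (π : Equiv.Perm (Fin k)) (σ : Equiv.Perm (Fin n)) : ℕ :=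
  (Finset.univ.filter fun i : Fin n =>
    ∃ h : (i : ℕ) + k ≤ n,
      InducesPattern σ (fun a : Fin k => ⟨(i : ℕ) + a, by have := a.isLt; omega⟩) π).card

/-- The proportion of consecutive occurrences of `π` in `σ`, normalised by the size of `σ`. -/
noncomputable def consecutiveDensity {k n : ℕ} (π : Equiv.Perm (Fin k))
    (σ : Equiv.Perm (Fin n)) : ℝ :=
  (consecutiveOcc π σ : ℝ) / (n : ℝ)

/-- The pattern-avoiding feasible region `P_k^{Av(B)}` for consecutive patterns of size `k`. -/
def feasibleRegion (k : ℕ) (B : Set AnyPerm) : Set (Equiv.Perm (Fin k) → ℝ) :=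
  {v | (∀ π, v π ∈ Set.Icc (0 : ℝ) 1) ∧
    ∃ σ : ℕ → AnyPerm, (∀ m, σ m ∈ AvClass B) ∧
      Tendsto (fun m => (σ m).1) atTop atTop ∧
      ∀ π : Equiv.Perm (Fin k),
        Tendsto (fun m => consecutiveDensity π (σ m).2) atTop (𝓝 (v π))}

/-- The decreasing permutation `n ⋯ 1` of size `n`. -/
def decreasing (n : ℕ) : AnyPerm := ⟨n, Fin.revPerm⟩

end ConsecutivePatterns

/-!
Write `k = K + 1`. The class `Av(n ⋯ 1)` is closed under direct sums `σ ⊕ τ` (`σ` followed by `τ`,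
shifted above it), and this is all that the argument uses besides nonemptiness.

*Convexity.* Densities of consecutive patterns in a direct sum of copies of `σ` and `τ` are, up to
an error caused by the boundedly many windows at each junction, the averages of those of `σ` and
`τ`, weighted by size (`abs_density_mixture_sub_le`).

*Dimension.* In the overlap graph the vertices are the avoiders of size `K` and the edges those of
size `K + 1`, an edge `π` leading from the pattern of its first `K` entries to that of its last `K`
entries. The windows of a permutation form a walk, so feasible vectors are circulations. The walk
of `ρ ⊕ ρ'` leads from `ρ` to `ρ'`, so the graph is connected and the space of circulations has
dimension `|Av_k| - |Av_{k-1}| + 1` (`finrank_circulations`).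

Conversely, every circulation lies in the span `S` of the feasible region. The repeated sum
`σ ⊕ σ ⊕ ⋯` shows that the window count of `σ`, plus the count `c(ρ, ρ')` of the windows of
`ρ ⊕ ρ'`, where `ρ` is the final and `ρ'` the initial pattern of size `K` of `σ`, belongs to `S`.
Applied to `ρ₁ ⊕ ρ₂ ⊕ ρ₃`, this says that `c` is an additive cocycle modulo `S`
(`junctionCount_cocycle`), hence a coboundary. Applied to an edge `π`, it then says that the unit
vector of `π` is, modulo `S`, a difference of potentials at its two ends
(`single_congr_junctionCount`), and such differences cancel along a circulation
(`circulations_le_span_feasibleRegion`). So `S` is the space of all circulations. As the coordinates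
of feasible vectors sum to one, the affine hull has one dimension less than `S`.
-/

namespace ConsecutivePatterns

open Equiv (Perm)

/-! ### Windows and standardisation -/

/-- The standardisation of a word `w`: for injective `w`, the permutation whose entries are in the
same relative order as those of `w`. -/
def std {α : Type*} [LinearOrder α] {k : ℕ} (w : Fin k → α) : Perm (Fin k) :=
  (Tuple.sort w)⁻¹

theorem std_lt_iff {α : Type*} [LinearOrder α] {k : ℕ} {w : Fin k → α}
    (hw : Function.Injective w) (a b : Fin k) : std w a < std w b ↔ w a < w b := by
  have hmono : StrictMono (w ∘ Tuple.sort w) :=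
    (Tuple.monotone_sort w).strictMono_of_injective (hw.comp (Tuple.sort w).injective)
  have := hmono.lt_iff_lt (a := std w a) (b := std w b)
  simpa [std] using this.symm

theorem perm_eq_of_lt_iff {k : ℕ} {π π' : Perm (Fin k)}
    (h : ∀ a b, π a < π b ↔ π' a < π' b) : π = π' := by
  let e : Fin k ≃o Fin k :=
    StrictMono.orderIsoOfSurjective (fun x => π' (π.symm x))
      (fun x y hxy => by rw [← h]; simpa using hxy) (π'.surjective.comp π.symm.surjective)
  have he : e = OrderIso.refl _ := Subsingleton.elim _ _
  ext a
  have h2 : e (π a) = π a := by rw [he]; rfl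
  have h3 : e (π a) = π' a := congrArg π' (π.symm_apply_apply a)
  rw [← h2, h3]

/-- The permutation `σ` of `{0, …, m - 1}` as a function on `ℕ`, continued by the identity. -/
def extend {m : ℕ} (σ : Perm (Fin m)) (j : ℕ) : ℕ :=
  if h : j < m then σ ⟨j, h⟩ else j

theorem extend_of_lt {m : ℕ} (σ : Perm (Fin m)) {j : ℕ} (h : j < m) :
    extend σ j = σ ⟨j, h⟩ := dif_pos h

theorem extend_of_le {m : ℕ} (σ : Perm (Fin m)) {j : ℕ} (h : m ≤ j) :
    extend σ j = j := dif_neg (not_lt.2 h)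

theorem extend_lt {m : ℕ} (σ : Perm (Fin m)) {j : ℕ} (h : j < m) : extend σ j < m := by
  rw [extend_of_lt σ h]
  exact (σ _).isLt

theorem extend_injective {m : ℕ} (σ : Perm (Fin m)) : Function.Injective (extend σ) := by
  intro i j hij
  rcases lt_or_ge i m with hi | hi <;> rcases lt_or_ge j m with hj | hj
  · rw [extend_of_lt σ hi, extend_of_lt σ hj] at hij
    simpa using σ.injective (Fin.ext hij)
  · have := extend_lt σ hi
    rw [hij, extend_of_le σ hj] at this
    omega
  · have := extend_lt σ hj
    rw [← hij, extend_of_le σ hi] at this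
    omega
  · rwa [extend_of_le σ hi, extend_of_le σ hj] at hij

/-- The pattern of the `k` consecutive entries of `σ` that start at position `i`. The entries
beyond the end of `σ` are those of `extend σ`. -/
def window {m : ℕ} (k : ℕ) (σ : Perm (Fin m)) (i : ℕ) : Perm (Fin k) :=
  std fun a : Fin k => extend σ (i + a)

theorem window_lt_iff {m k : ℕ} (σ : Perm (Fin m)) (i : ℕ) (a b : Fin k) :
    window k σ i a < window k σ i b ↔ extend σ (i + a) < extend σ (i + b) := by
  refine std_lt_iff (w := fun a : Fin k => extend σ (i + a)) (fun x y hxy => ?_) a b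
  have := extend_injective σ hxy
  exact Fin.ext (by omega)

theorem window_eq_of_lt_iff {m k : ℕ} {σ : Perm (Fin m)} {i : ℕ} {π : Perm (Fin k)}
    (h : ∀ a b : Fin k, π a < π b ↔ extend σ (i + a) < extend σ (i + b)) : window k σ i = π :=
  perm_eq_of_lt_iff fun a b => by rw [window_lt_iff, h]

theorem window_congr {m m' k : ℕ} {σ : Perm (Fin m)} {σ' : Perm (Fin m')} {i i' : ℕ}
    (h : ∀ a b, a < k → b < k →
      (extend σ (i + a) < extend σ (i + b) ↔ extend σ' (i' + a) < extend σ' (i' + b))) :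
    window k σ i = window k σ' i' :=
  window_eq_of_lt_iff fun a b => by rw [window_lt_iff, h a b a.isLt b.isLt]

theorem extend_window_lt_iff {m k : ℕ} (σ : Perm (Fin m)) (i : ℕ) {a b : ℕ} (ha : a < k)
    (hb : b < k) : extend (window k σ i) a < extend (window k σ i) b ↔
      extend σ (i + a) < extend σ (i + b) := by
  rw [extend_of_lt _ ha, extend_of_lt _ hb, Fin.val_fin_lt, window_lt_iff]

theorem window_window {m k l : ℕ} (σ : Perm (Fin m)) (i : ℕ) {j : ℕ} (h : j + l ≤ k) :
    window l (window k σ i) j = window l σ (i + j) :=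
  window_congr fun a b ha hb => by
    rw [extend_window_lt_iff σ i (by omega) (by omega), add_assoc, add_assoc]

theorem window_self {k : ℕ} (σ : Perm (Fin k)) : window k σ 0 = σ :=
  window_eq_of_lt_iff fun a b => by
    rw [extend_of_lt σ (by omega), extend_of_lt σ (by omega)]
    simp

/-! ### Direct sums -/

/-- The direct sum `σ ⊕ τ`: the entries of `σ`, followed by those of `τ`, which are all larger. -/
def directSum {m n : ℕ} (σ : Perm (Fin m)) (τ : Perm (Fin n)) : Perm (Fin (m + n)) :=
  finSumFinEquiv.permCongr (Equiv.Perm.sumCongr σ τ)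

theorem directSum_castAdd {m n : ℕ} (σ : Perm (Fin m)) (τ : Perm (Fin n)) (a : Fin m) :
    directSum σ τ (Fin.castAdd n a) = Fin.castAdd n (σ a) := by
  simp [directSum, Equiv.permCongr_apply]

theorem directSum_natAdd {m n : ℕ} (σ : Perm (Fin m)) (τ : Perm (Fin n)) (a : Fin n) :
    directSum σ τ (Fin.natAdd m a) = Fin.natAdd m (τ a) := by
  simp [directSum, Equiv.permCongr_apply]

theorem extend_directSum_of_lt {m n : ℕ} (σ : Perm (Fin m)) (τ : Perm (Fin n)) {j : ℕ}
    (h : j < m) : extend (directSum σ τ) j = extend σ j := by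
  rw [extend_of_lt _ (show j < m + n by omega), extend_of_lt σ h]
  exact congrArg Fin.val (directSum_castAdd σ τ ⟨j, h⟩)

theorem extend_directSum_add {m n : ℕ} (σ : Perm (Fin m)) (τ : Perm (Fin n)) (j : ℕ) :
    extend (directSum σ τ) (m + j) = m + extend τ j := by
  rcases lt_or_ge j n with h | h
  · rw [extend_of_lt _ (show m + j < m + n by omega), extend_of_lt τ h]
    exact congrArg Fin.val (directSum_natAdd σ τ ⟨j, h⟩)
  · rw [extend_of_le _ (show m + n ≤ m + j by omega), extend_of_le τ h]

theorem window_directSum_left {m n k : ℕ} (σ : Perm (Fin m)) (τ : Perm (Fin n)) {i : ℕ}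
    (h : i + k ≤ m) : window k (directSum σ τ) i = window k σ i :=
  window_congr fun a b ha hb => by
    rw [extend_directSum_of_lt σ τ (by omega), extend_directSum_of_lt σ τ (by omega)]

theorem window_directSum_right {m n k : ℕ} (σ : Perm (Fin m)) (τ : Perm (Fin n)) (i : ℕ) :
    window k (directSum σ τ) (m + i) = window k τ i :=
  window_congr fun a b ha hb => by
    rw [add_assoc, add_assoc, extend_directSum_add, extend_directSum_add,
      Nat.add_lt_add_iff_left]

/-- The windows of `σ ⊕ τ` near the junction see only the last `K` entries of `σ` and the first
`K` entries of `τ`. -/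
theorem window_directSum_junction {m n l K : ℕ} (σ : Perm (Fin m)) (τ : Perm (Fin n))
    (hm : K ≤ m) {j : ℕ} (hj : j + l ≤ K + K) :
    window l (directSum σ τ) (m - K + j) =
      window l (directSum (window K σ (m - K)) (window K τ 0)) j := by
  have low : ∀ c, c < K → extend (directSum σ τ) (m - K + c) = extend σ (m - K + c) :=
    fun c hc => extend_directSum_of_lt σ τ (by omega)
  have high : ∀ c, extend (directSum σ τ) (m - K + (K + c)) = m + extend τ c := fun c => by
    rw [← extend_directSum_add σ τ c]
    congr 1
    omega
  have key : ∀ c d, c < K + K → d < K + K →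
      (extend (directSum σ τ) (m - K + c) < extend (directSum σ τ) (m - K + d) ↔
        extend (directSum (window K σ (m - K)) (window K τ 0)) c <
          extend (directSum (window K σ (m - K)) (window K τ 0)) d) := by
    intro c d hc hd
    rcases lt_or_ge c K with h1 | h1 <;> rcases lt_or_ge d K with h2 | h2
    · rw [low c h1, low d h2, extend_directSum_of_lt _ _ h1, extend_directSum_of_lt _ _ h2,
        extend_window_lt_iff σ _ h1 h2]
    · obtain ⟨d, rfl⟩ := Nat.exists_eq_add_of_le h2
      rw [low c h1, high, extend_directSum_of_lt _ _ h1, extend_directSum_add]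
      have := extend_lt σ (show m - K + c < m by omega)
      have := extend_lt (window K σ (m - K)) h1
      omega
    · obtain ⟨c, rfl⟩ := Nat.exists_eq_add_of_le h1
      rw [low d h2, high, extend_directSum_of_lt _ _ h2, extend_directSum_add]
      have := extend_lt σ (show m - K + d < m by omega)
      have := extend_lt (window K σ (m - K)) h2
      omega
    · obtain ⟨c, rfl⟩ := Nat.exists_eq_add_of_le h1
      obtain ⟨d, rfl⟩ := Nat.exists_eq_add_of_le h2
      rw [high, high, extend_directSum_add, extend_directSum_add, Nat.add_lt_add_iff_left,
        Nat.add_lt_add_iff_left, extend_window_lt_iff τ 0 (by omega) (by omega), zero_add,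
        zero_add]
  refine window_congr fun a b ha hb => ?_
  rw [add_assoc, add_assoc]
  exact key _ _ (by omega) (by omega)

/-! ### The vector of window counts -/

/-- The vector of the numbers of consecutive occurrences in `σ` of the patterns of size `K + 1`,
written as a sum of one unit vector for each window. -/
def windowCount {m : ℕ} (K : ℕ) (σ : Perm (Fin m)) : Perm (Fin (K + 1)) → ℝ :=
  ∑ i ∈ Finset.range (m - K), Pi.single (window (K + 1) σ i) 1

theorem inducesPattern_iff_window {m k : ℕ} (σ : Perm (Fin m)) (π : Perm (Fin k)) {i : ℕ}
    (h : i + k ≤ m) :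
    InducesPattern σ (fun a : Fin k => ⟨i + a, by have := a.isLt; omega⟩) π ↔
      window k σ i = π := by
  have key : ∀ a b : Fin k, (σ ⟨i + a, by have := a.isLt; omega⟩ <
      σ ⟨i + b, by have := b.isLt; omega⟩ ↔ extend σ (i + a) < extend σ (i + b)) := fun a b => by
    rw [extend_of_lt σ (show i + (a : ℕ) < m by omega),
      extend_of_lt σ (show i + (b : ℕ) < m by omega), Fin.val_fin_lt]
  constructor
  · intro hp
    exact window_eq_of_lt_iff fun a b => (hp a b).trans (key a b)
  · rintro rfl a b
    rw [window_lt_iff, key]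

theorem windowCount_apply {m K : ℕ} (σ : Perm (Fin m)) (π : Perm (Fin (K + 1))) :
    windowCount K σ π = consecutiveOcc π σ := by
  classical
  rw [windowCount, Finset.sum_apply, consecutiveOcc]
  simp only [Pi.single_apply, Finset.sum_boole, Nat.cast_inj]
  symm
  refine Finset.card_bij (fun i _ => (i : ℕ)) ?_ (fun a _ b _ h => Fin.ext h) ?_
  · intro i hi
    obtain ⟨h, hp⟩ := (Finset.mem_filter.1 hi).2
    rw [Finset.mem_filter, Finset.mem_range]
    exact ⟨by omega, ((inducesPattern_iff_window σ π h).1 hp).symm⟩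
  · intro i hi
    rw [Finset.mem_filter, Finset.mem_range] at hi
    have h : i + (K + 1) ≤ m := by omega
    exact ⟨⟨i, by omega⟩, Finset.mem_filter.2 ⟨Finset.mem_univ _, h,
      (inducesPattern_iff_window σ π h).2 hi.2.symm⟩, rfl⟩

theorem windowCount_nonneg {m K : ℕ} (σ : Perm (Fin m)) (π : Perm (Fin (K + 1))) :
    0 ≤ windowCount K σ π := by
  rw [windowCount_apply]
  exact Nat.cast_nonneg _

theorem sum_windowCount {m K : ℕ} (σ : Perm (Fin m)) :
    ∑ π, windowCount K σ π = ((m - K : ℕ) : ℝ) := by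
  simp only [windowCount, Finset.sum_apply]
  rw [Finset.sum_comm]
  simp

theorem windowCount_le {m K : ℕ} (σ : Perm (Fin m)) (π : Perm (Fin (K + 1))) :
    windowCount K σ π ≤ ((m - K : ℕ) : ℝ) := by
  rw [← sum_windowCount σ]
  exact Finset.single_le_sum (f := windowCount K σ) (fun π _ => windowCount_nonneg σ π)
    (Finset.mem_univ π)

theorem windowCount_of_le {m K : ℕ} (σ : Perm (Fin m)) (h : m ≤ K) : windowCount K σ = 0 := by
  simp [windowCount, Nat.sub_eq_zero_of_le h]

theorem windowCount_self {K : ℕ} (π : Perm (Fin (K + 1))) :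
    windowCount K π = Pi.single π 1 := by
  simp [windowCount, window_self]

/-- The correction term in the window count of `σ ⊕ τ`, coming from the windows that meet both
summands. -/
def junctionCount {m n : ℕ} (K : ℕ) (σ : Perm (Fin m)) (τ : Perm (Fin n)) :
    Perm (Fin (K + 1)) → ℝ :=
  windowCount K (directSum (window K σ (m - K)) (window K τ 0))

theorem windowCount_directSum {m n K : ℕ} (σ : Perm (Fin m)) (τ : Perm (Fin n)) (hm : K ≤ m)
    (hn : K ≤ n) : windowCount K (directSum σ τ) =
      windowCount K σ + windowCount K τ + junctionCount K σ τ := by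
  have hsize : m + n - K = (m - K + K) + (n - K) := by omega
  rw [windowCount, hsize, Finset.sum_range_add, Finset.sum_range_add, junctionCount]
  have h1 : ∑ i ∈ Finset.range (m - K),
      (Pi.single (window (K + 1) (directSum σ τ) i) 1 : Perm (Fin (K + 1)) → ℝ) =
        windowCount K σ :=
    Finset.sum_congr rfl fun i hi => by
      rw [window_directSum_left σ τ (by have := Finset.mem_range.1 hi; omega)]
  have h2 : ∑ i ∈ Finset.range K,
      (Pi.single (window (K + 1) (directSum σ τ) (m - K + i)) 1 : Perm (Fin (K + 1)) → ℝ) =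
        windowCount K (directSum (window K σ (m - K)) (window K τ 0)) := by
    rw [windowCount, Nat.add_sub_cancel]
    exact Finset.sum_congr rfl fun i hi => by
      rw [window_directSum_junction σ τ hm (by have := Finset.mem_range.1 hi; omega)]
  have h3 : ∑ i ∈ Finset.range (n - K),
      (Pi.single (window (K + 1) (directSum σ τ) (m - K + K + i)) 1 :
        Perm (Fin (K + 1)) → ℝ) = windowCount K τ :=
    Finset.sum_congr rfl fun i _ => by
      rw [Nat.sub_add_cancel hm, window_directSum_right]
  rw [h1, h2, h3]
  abel

theorem junctionCount_nonneg {m n K : ℕ} (σ : Perm (Fin m)) (τ : Perm (Fin n))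
    (π : Perm (Fin (K + 1))) : 0 ≤ junctionCount K σ τ π :=
  windowCount_nonneg _ π

theorem junctionCount_le {m n K : ℕ} (σ : Perm (Fin m)) (τ : Perm (Fin n))
    (π : Perm (Fin (K + 1))) : junctionCount K σ τ π ≤ K := by
  have := windowCount_le (directSum (window K σ (m - K)) (window K τ 0)) π
  rwa [Nat.add_sub_cancel] at this

theorem junctionCount_directSum_left {l m n K : ℕ} (σ : Perm (Fin l)) (τ : Perm (Fin m))
    (υ : Perm (Fin n)) (hm : K ≤ m) :
    junctionCount K (directSum σ τ) υ = junctionCount K τ υ := by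
  rw [junctionCount, junctionCount, Nat.add_sub_assoc hm, window_directSum_right]

theorem junctionCount_directSum_right {l m n K : ℕ} (σ : Perm (Fin l)) (τ : Perm (Fin m))
    (υ : Perm (Fin n)) (hm : K ≤ m) :
    junctionCount K σ (directSum τ υ) = junctionCount K σ τ := by
  rw [junctionCount, junctionCount, window_directSum_left τ υ (by omega)]

theorem junctionCount_of_size {K : ℕ} (ρ ρ' : Perm (Fin K)) :
    junctionCount K ρ ρ' = windowCount K (directSum ρ ρ') := by
  rw [junctionCount, Nat.sub_self, window_self, window_self]

/-- The `(j + 1)`-fold direct sum `σ ⊕ ⋯ ⊕ σ`. -/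
def directSumPow (σ : AnyPerm) : ℕ → AnyPerm
  | 0 => σ
  | j + 1 => ⟨(directSumPow σ j).1 + σ.1, directSum (directSumPow σ j).2 σ.2⟩

theorem directSumPow_size (σ : AnyPerm) (j : ℕ) : (directSumPow σ j).1 = (j + 1) * σ.1 := by
  induction j with
  | zero => simp [directSumPow]
  | succ j ih =>
    change (directSumPow σ j).1 + σ.1 = _
    rw [ih]
    ring

theorem size_le_directSumPow (σ : AnyPerm) (j : ℕ) : σ.1 ≤ (directSumPow σ j).1 := by
  rw [directSumPow_size]
  exact Nat.le_mul_of_pos_left _ j.succ_pos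

theorem junctionCount_directSumPow_left {n K : ℕ} (σ : AnyPerm) (hσ : K ≤ σ.1) (j : ℕ)
    (τ : Perm (Fin n)) : junctionCount K (directSumPow σ j).2 τ = junctionCount K σ.2 τ := by
  cases j with
  | zero => rfl
  | succ j => exact junctionCount_directSum_left _ _ _ hσ

theorem junctionCount_directSumPow_right {n K : ℕ} (σ : AnyPerm) (hσ : K ≤ σ.1) (j : ℕ)
    (τ : Perm (Fin n)) : junctionCount K τ (directSumPow σ j).2 = junctionCount K τ σ.2 := by
  induction j with
  | zero => rfl
  | succ j ih =>
    rw [← ih]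
    exact junctionCount_directSum_right _ _ _ (hσ.trans (size_le_directSumPow σ j))

theorem windowCount_directSumPow {K : ℕ} (σ : AnyPerm) (hσ : K ≤ σ.1) (j : ℕ) :
    windowCount K (directSumPow σ j).2 =
      ((j : ℝ) + 1) • windowCount K σ.2 + (j : ℝ) • junctionCount K σ.2 σ.2 := by
  induction j with
  | zero => simp [directSumPow]
  | succ j ih =>
    rw [directSumPow, windowCount_directSum _ _ (hσ.trans (size_le_directSumPow σ j)) hσ, ih,
      junctionCount_directSumPow_left σ hσ]
    push_cast
    module

/-! ### Classes closed under direct sums -/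

/-- The class `Av(B)` is closed under direct sums. -/
def DirectSumClosed (B : Set AnyPerm) : Prop :=
  ∀ ⦃m n : ℕ⦄ ⦃σ : Perm (Fin m)⦄ ⦃τ : Perm (Fin n)⦄,
    σ ∈ Av B m → τ ∈ Av B n → directSum σ τ ∈ Av B (m + n)

theorem window_mem_Av {B : Set AnyPerm} {m k : ℕ} {σ : Perm (Fin m)} (hσ : σ ∈ Av B m) {i : ℕ}
    (h : i + k ≤ m) : window k σ i ∈ Av B k := by
  rintro τ hτ ⟨f, hf⟩
  let g : Fin k ↪o Fin m := OrderEmbedding.ofStrictMono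
    (fun a : Fin k => ⟨i + a, by have := a.isLt; omega⟩)
    (fun a b hab => Fin.mk_lt_mk.2 (Nat.add_lt_add_left hab i))
  refine hσ τ hτ ⟨f.trans g, fun a b => (hf a b).trans ?_⟩
  exact (inducesPattern_iff_window σ (window k σ i) h).2 rfl (f a) (f b)

theorem directSumPow_mem_AvClass {B : Set AnyPerm} (hB : DirectSumClosed B) {σ : AnyPerm}
    (hσ : σ ∈ AvClass B) (j : ℕ) : directSumPow σ j ∈ AvClass B := by
  refine ⟨hσ.1.trans (size_le_directSumPow σ j), ?_⟩
  induction j with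
  | zero => exact hσ.2
  | succ j ih => exact hB ih hσ.2

theorem mem_Av_decreasing_iff {n m : ℕ} {σ : Perm (Fin m)} : σ ∈ Av {decreasing n} m ↔
    ¬ ∃ f : Fin n ↪o Fin m, ∀ a b : Fin n, a.rev < b.rev ↔ σ (f a) < σ (f b) :=
  ⟨fun h => h _ rfl, fun h _ hτ => hτ ▸ h⟩

/-- A decreasing pattern of size at least two cannot meet both summands of a direct sum. -/
theorem directSumClosed_decreasing {n : ℕ} (hn : 2 ≤ n) : DirectSumClosed {decreasing n} := by
  intro l m σ τ hσ hτ
  rw [mem_Av_decreasing_iff] at hσ hτ ⊢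
  rintro ⟨f, hf⟩
  have hval : ∀ a b : Fin n, a.rev < b.rev ↔
      extend (directSum σ τ) (f a) < extend (directSum σ τ) (f b) := fun a b => by
    rw [hf, extend_of_lt _ (f a).isLt, extend_of_lt _ (f b).isLt, Fin.val_fin_lt]
  have hmono : ∀ a b : Fin n, a ≤ b → (f a : ℕ) ≤ f b := fun a b hab => f.monotone hab
  by_cases hlast : (f ⟨n - 1, by omega⟩ : ℕ) < l
  · have hlt : ∀ a, (f a : ℕ) < l := fun a =>
      (hmono a ⟨n - 1, by omega⟩ (Fin.mk_le_mk.2 (by omega))).trans_lt hlast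
    refine hσ ⟨OrderEmbedding.ofStrictMono (fun a => ⟨f a, hlt a⟩)
      (fun a b hab => Fin.mk_lt_mk.2 (f.strictMono hab)), fun a b => (hval a b).trans ?_⟩
    rw [extend_directSum_of_lt σ τ (hlt a), extend_directSum_of_lt σ τ (hlt b),
      extend_of_lt σ (hlt a), extend_of_lt σ (hlt b), Fin.val_fin_lt]
    rfl
  by_cases hfirst : l ≤ (f ⟨0, by omega⟩ : ℕ)
  · have hge : ∀ a, l ≤ (f a : ℕ) := fun a =>
      hfirst.trans (hmono ⟨0, by omega⟩ a (Fin.mk_le_mk.2 (by omega)))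
    have hlt : ∀ a, (f a : ℕ) - l < m := fun a => by
      have := (f a).isLt
      have := hge a
      omega
    have hext : ∀ a, extend (directSum σ τ) (f a) = l + τ ⟨f a - l, hlt a⟩ := fun a => by
      rw [← extend_of_lt τ (hlt a), ← extend_directSum_add σ τ, Nat.add_sub_cancel' (hge a)]
    refine hτ ⟨OrderEmbedding.ofStrictMono (fun a => ⟨f a - l, hlt a⟩)
      (fun a b hab => Fin.mk_lt_mk.2 ?_), fun a b => (hval a b).trans ?_⟩
    · have : (f a : ℕ) < f b := f.strictMono hab
      have := hge a
      omega
    · rw [hext, hext, Nat.add_lt_add_iff_left, Fin.val_fin_lt]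
      rfl
  · -- the first entry lies in `σ` and the last one in `τ`, so they are not in decreasing order
    have h := (hval ⟨n - 1, by omega⟩ ⟨0, by omega⟩).1
      (Fin.rev_lt_rev.2 (Fin.mk_lt_mk.2 (by omega)))
    obtain ⟨c, hc⟩ := Nat.exists_eq_add_of_le (not_lt.1 hlast)
    rw [hc, extend_directSum_add, extend_directSum_of_lt σ τ (not_le.1 hfirst)] at h
    have := extend_lt σ (not_le.1 hfirst)
    omega

theorem one_mem_Av_decreasing {n : ℕ} (hn : 2 ≤ n) (m : ℕ) :
    (1 : Perm (Fin m)) ∈ Av {decreasing n} m := by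
  rw [mem_Av_decreasing_iff]
  rintro ⟨f, hf⟩
  have h := (hf ⟨1, hn⟩ ⟨0, by omega⟩).1 (Fin.rev_lt_rev.2 (Fin.mk_lt_mk.2 one_pos))
  exact absurd (Fin.mk_lt_mk.1 (f.lt_iff_lt.1 h)) (by omega)

/-! ### Points of the feasible region -/

/-- The vector of the densities of the patterns of size `K + 1` in `σ`. -/
noncomputable def density (K : ℕ) (σ : AnyPerm) : Perm (Fin (K + 1)) → ℝ :=
  (σ.1 : ℝ)⁻¹ • windowCount K σ.2

theorem density_apply {K : ℕ} (σ : AnyPerm) (π : Perm (Fin (K + 1))) :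
    density K σ π = consecutiveDensity π σ.2 := by
  rw [density, Pi.smul_apply, windowCount_apply, consecutiveDensity, smul_eq_mul, div_eq_inv_mul]

theorem density_mem_Icc {K : ℕ} (σ : AnyPerm) (π : Perm (Fin (K + 1))) :
    density K σ π ∈ Set.Icc (0 : ℝ) 1 := by
  rw [density, Pi.smul_apply, smul_eq_mul, ← div_eq_inv_mul]
  refine ⟨div_nonneg (windowCount_nonneg _ _) (Nat.cast_nonneg _),
    div_le_one_of_le₀ ((windowCount_le _ _).trans ?_) (Nat.cast_nonneg _)⟩
  exact_mod_cast Nat.sub_le _ _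

theorem mem_feasibleRegion_iff {K : ℕ} {B : Set AnyPerm} {v : Perm (Fin (K + 1)) → ℝ} :
    v ∈ feasibleRegion (K + 1) B ↔
      ∃ σ : ℕ → AnyPerm, (∀ m, σ m ∈ AvClass B) ∧ (∀ m, K ≤ (σ m).1) ∧
        Tendsto (fun m => (σ m).1) atTop atTop ∧
        Tendsto (fun m => density K (σ m)) atTop (𝓝 v) := by
  constructor
  · rintro ⟨-, σ, hσ, hsize, hlim⟩
    obtain ⟨M, hM⟩ := eventually_atTop.1 (hsize.eventually_ge_atTop K)
    refine ⟨fun m => σ (m + M), fun m => hσ _, fun m => hM _ (Nat.le_add_left _ _),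
      hsize.comp (tendsto_add_atTop_nat M), tendsto_pi_nhds.2 fun π => ?_⟩
    simp only [density_apply]
    exact (hlim π).comp (tendsto_add_atTop_nat M)
  · rintro ⟨σ, hσ, -, hsize, hlim⟩
    have hlim' := tendsto_pi_nhds.1 hlim
    refine ⟨fun π => isClosed_Icc.mem_of_tendsto (hlim' π)
      (Eventually.of_forall fun m => density_mem_Icc _ _), σ, hσ, hsize, fun π => ?_⟩
    simpa only [density_apply] using hlim' π

/-- The densities in `σ ⊕ ⋯ ⊕ σ` converge to a feasible point. -/
theorem periodic_mem_feasibleRegion {K : ℕ} {B : Set AnyPerm} (hB : DirectSumClosed B)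
    {σ : AnyPerm} (hσ : σ ∈ AvClass B) (hK : K ≤ σ.1) :
    (σ.1 : ℝ)⁻¹ • (windowCount K σ.2 + junctionCount K σ.2 σ.2) ∈
      feasibleRegion (K + 1) B := by
  refine mem_feasibleRegion_iff.2 ⟨directSumPow σ, directSumPow_mem_AvClass hB hσ,
    fun j => hK.trans (size_le_directSumPow σ j), ?_, ?_⟩
  · refine tendsto_atTop_mono (fun j => ?_) tendsto_id
    rw [directSumPow_size]
    have := Nat.le_mul_of_pos_right (j + 1) hσ.1
    exact (Nat.le_succ j).trans this
  · have heq : ∀ j : ℕ, density K (directSumPow σ j) =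
        (σ.1 : ℝ)⁻¹ • (windowCount K σ.2 + ((j : ℝ) / (j + 1)) • junctionCount K σ.2 σ.2) := by
      intro j
      have hj : (j : ℝ) + 1 ≠ 0 := by positivity
      rw [density, windowCount_directSumPow σ hK, directSumPow_size, Nat.cast_mul, mul_inv,
        mul_comm, mul_smul, smul_add, smul_smul, smul_smul, Nat.cast_add_one,
        inv_mul_cancel₀ hj, one_smul, div_eq_inv_mul]
    simp_rw [heq]
    have hlim := tendsto_natCast_div_add_atTop (1 : ℝ)
    simpa using ((hlim.smul_const (junctionCount K σ.2 σ.2)).const_add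
      (windowCount K σ.2)).const_smul (σ.1 : ℝ)⁻¹

/-! ### Convexity -/

/-- A direct sum of copies of `σ` and of `τ` whose total sizes are in the ratio `p : q`. -/
def mixture (p q : ℕ) (σ τ : AnyPerm) : AnyPerm :=
  ⟨_, directSum (directSumPow σ (p * τ.1 - 1)).2 (directSumPow τ (q * σ.1 - 1)).2⟩

theorem mixture_size {p q : ℕ} (hp : 1 ≤ p) (hq : 1 ≤ q) {σ τ : AnyPerm} (hσ : 1 ≤ σ.1)
    (hτ : 1 ≤ τ.1) : (mixture p q σ τ).1 = (p + q) * (σ.1 * τ.1) := by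
  change (directSumPow σ (p * τ.1 - 1)).1 + (directSumPow τ (q * σ.1 - 1)).1 = _
  rw [directSumPow_size, directSumPow_size, Nat.sub_add_cancel (Nat.mul_pos hp hτ),
    Nat.sub_add_cancel (Nat.mul_pos hq hσ)]
  ring

theorem abs_density_mixture_sub_le {K p q : ℕ} (hp : 1 ≤ p) (hq : 1 ≤ q) {σ τ : AnyPerm}
    (hσ : 1 ≤ σ.1) (hτ : 1 ≤ τ.1) (hσK : K ≤ σ.1) (hτK : K ≤ τ.1) (π : Perm (Fin (K + 1))) :
    |density K (mixture p q σ τ) π -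
        ((p : ℝ) / (p + q) * density K σ π + (q : ℝ) / (p + q) * density K τ π)| ≤
      K * ((σ.1 : ℝ)⁻¹ + (τ.1 : ℝ)⁻¹) := by
  have hcount : windowCount K (mixture p q σ τ).2 π =
      (p * τ.1) * windowCount K σ.2 π + (p * τ.1 - 1) * junctionCount K σ.2 σ.2 π +
      ((q * σ.1) * windowCount K τ.2 π + (q * σ.1 - 1) * junctionCount K τ.2 τ.2 π) +
      junctionCount K σ.2 τ.2 π := by
    have h1 : ((p * τ.1 - 1 : ℕ) : ℝ) = p * τ.1 - 1 := by
      rw [Nat.cast_sub (Nat.mul_pos hp hτ)]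
      push_cast
      ring
    have h2 : ((q * σ.1 - 1 : ℕ) : ℝ) = q * σ.1 - 1 := by
      rw [Nat.cast_sub (Nat.mul_pos hq hσ)]
      push_cast
      ring
    rw [mixture, windowCount_directSum _ _ (hσK.trans (size_le_directSumPow σ _))
      (hτK.trans (size_le_directSumPow τ _)), windowCount_directSumPow σ hσK,
      windowCount_directSumPow τ hτK, junctionCount_directSumPow_left σ hσK,
      junctionCount_directSumPow_right τ hτK, h1, h2]
    simp only [Pi.add_apply, Pi.smul_apply, smul_eq_mul]
    ring
  have hp' : (1 : ℝ) ≤ p := by exact_mod_cast hp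
  have hq' : (1 : ℝ) ≤ q := by exact_mod_cast hq
  have hσ' : (1 : ℝ) ≤ σ.1 := by exact_mod_cast hσ
  have hτ' : (1 : ℝ) ≤ τ.1 := by exact_mod_cast hτ
  simp only [density, Pi.smul_apply, smul_eq_mul]
  rw [hcount, mixture_size hp hq hσ hτ]
  push_cast
  generalize (σ.1 : ℝ) = s at *
  generalize (τ.1 : ℝ) = u at *
  generalize (p : ℝ) = x at *
  generalize (q : ℝ) = y at *
  have j1 := junctionCount_nonneg (K := K) σ.2 σ.2 π
  have j2 := junctionCount_nonneg (K := K) τ.2 τ.2 π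
  have j3 := junctionCount_nonneg (K := K) σ.2 τ.2 π
  have l1 := junctionCount_le (K := K) σ.2 σ.2 π
  have l2 := junctionCount_le (K := K) τ.2 τ.2 π
  have l3 := junctionCount_le (K := K) σ.2 τ.2 π
  generalize junctionCount K σ.2 σ.2 π = c1 at *
  generalize junctionCount K τ.2 τ.2 π = c2 at *
  generalize junctionCount K σ.2 τ.2 π = c3 at *
  have hs : 0 < s := by linarith
  have hu : 0 < u := by linarith
  have hx : 0 < x := by linarith
  have hy : 0 < y := by linarith
  have hxu : 1 ≤ x * u := one_le_mul_of_one_le_of_one_le hp' hτ'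
  have hys : 1 ≤ y * s := one_le_mul_of_one_le_of_one_le hq' hσ'
  have herr : ((x + y) * (s * u))⁻¹ *
      (x * u * windowCount K σ.2 π + (x * u - 1) * c1 +
        (y * s * windowCount K τ.2 π + (y * s - 1) * c2) + c3) -
      (x / (x + y) * (s⁻¹ * windowCount K σ.2 π) + y / (x + y) * (u⁻¹ * windowCount K τ.2 π)) =
      ((x * u - 1) * c1 + (y * s - 1) * c2 + c3) / ((x + y) * (s * u)) := by
    field_simp
    ring
  rw [herr, abs_of_nonneg (by
    have := mul_nonneg (sub_nonneg.2 hxu) j1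
    have := mul_nonneg (sub_nonneg.2 hys) j2
    positivity), div_le_iff₀ (by positivity)]
  have e1 := mul_le_mul_of_nonneg_left l1 (sub_nonneg.2 hxu)
  have e2 := mul_le_mul_of_nonneg_left l2 (sub_nonneg.2 hys)
  have hK : (0 : ℝ) ≤ K := Nat.cast_nonneg K
  have hrhs : (K : ℝ) * (s⁻¹ + u⁻¹) * ((x + y) * (s * u)) = K * ((x + y) * (u + s)) := by
    field_simp
  rw [hrhs]
  have e3 : 0 ≤ (K : ℝ) * (x * s + y * u + 1) := by positivity
  linarith

theorem convex_feasibleRegion {K : ℕ} {B : Set AnyPerm} (hB : DirectSumClosed B) :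
    Convex ℝ (feasibleRegion (K + 1) B) := by
  rw [convex_iff_forall_pos]
  intro v hv w hw a b ha hb hab
  obtain ⟨σ, hσ, hσK, hσsize, hσlim⟩ := mem_feasibleRegion_iff.1 hv
  obtain ⟨τ, hτ, hτK, hτsize, hτlim⟩ := mem_feasibleRegion_iff.1 hw
  let p : ℕ → ℕ := fun m => ⌊a * m⌋₊ + 1
  let q : ℕ → ℕ := fun m => ⌊b * m⌋₊ + 1
  have hlim : ∀ c : ℝ, 0 < c →
      Tendsto (fun m : ℕ => ((⌊c * m⌋₊ + 1 : ℕ) : ℝ) / m) atTop (𝓝 c) := by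
    intro c hc
    have h := ((tendsto_nat_floor_mul_div_atTop hc.le).comp tendsto_natCast_atTop_atTop).add
      (tendsto_one_div_atTop_nhds_zero_nat (𝕜 := ℝ))
    rw [add_zero] at h
    refine h.congr fun m => ?_
    simp only [Function.comp_apply]
    push_cast
    ring
  have hratio : ∀ c d : ℝ, 0 < c → 0 < d → c + d = 1 →
      Tendsto (fun m : ℕ => ((⌊c * m⌋₊ + 1 : ℕ) : ℝ) /
        ((⌊c * m⌋₊ + 1 : ℕ) + (⌊d * m⌋₊ + 1 : ℕ))) atTop (𝓝 c) := by
    intro c d hc hd hcd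
    have h := (hlim c hc).div ((hlim c hc).add (hlim d hd)) (by rw [hcd]; exact one_ne_zero)
    rw [hcd, div_one] at h
    refine h.congr' ?_
    filter_upwards [eventually_gt_atTop 0] with m hm
    have hm' : (m : ℝ) ≠ 0 := by exact_mod_cast hm.ne'
    simp only [Pi.div_apply]
    rw [← add_div, div_div_div_cancel_right₀ hm']
  have hp : Tendsto (fun m => (p m : ℝ) / (p m + q m)) atTop (𝓝 a) := hratio a b ha hb hab
  have hq : Tendsto (fun m => (q m : ℝ) / (p m + q m)) atTop (𝓝 b) := by
    have := hratio b a hb ha (by rw [add_comm, hab])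
    simpa only [p, q, add_comm] using this
  have hsize : ∀ m, (σ m).1 ≤ (mixture (p m) (q m) (σ m) (τ m)).1 := fun m =>
    (size_le_directSumPow _ _).trans (Nat.le_add_right _ _)
  refine mem_feasibleRegion_iff.2 ⟨fun m => mixture (p m) (q m) (σ m) (τ m), fun m => ?_,
    fun m => (hσK m).trans (hsize m), tendsto_atTop_mono hsize hσsize,
    tendsto_pi_nhds.2 fun π => ?_⟩
  · exact ⟨(hσ m).1.trans (hsize m), hB (directSumPow_mem_AvClass hB (hσ m) _).2
      (directSumPow_mem_AvClass hB (hτ m) _).2⟩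
  · have hmain := (hp.mul (tendsto_pi_nhds.1 hσlim π)).add (hq.mul (tendsto_pi_nhds.1 hτlim π))
    have hinv : ∀ ρ : ℕ → AnyPerm, Tendsto (fun m => (ρ m).1) atTop atTop →
        Tendsto (fun m => ((ρ m).1 : ℝ)⁻¹) atTop (𝓝 0) := fun ρ h =>
      tendsto_inv_atTop_zero.comp (tendsto_natCast_atTop_atTop.comp h)
    have hbound := ((hinv σ hσsize).add (hinv τ hτsize)).const_mul (K : ℝ)
    rw [add_zero, mul_zero] at hbound
    have herr := squeeze_zero_norm (a := fun m => (K : ℝ) * (((σ m).1 : ℝ)⁻¹ + ((τ m).1 : ℝ)⁻¹))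
      (fun m => (Real.norm_eq_abs _).trans_le <| abs_density_mixture_sub_le
      (p := p m) (q := q m) (Nat.le_add_left _ _) (Nat.le_add_left _ _) (hσ m).1 (hτ m).1
      (hσK m) (hτK m) π) hbound
    simpa using herr.add hmain

/-! ### The overlap graph -/

/-- The boundary map of the overlap graph, whose edges are the permutations `π` of size `K + 1` and
whose vertices are those of size `K`: the edge `π` leads from the pattern of its first `K` entries
to the pattern of its last `K` entries. -/
noncomputable def boundary (K : ℕ) : (Perm (Fin (K + 1)) → ℝ) →ₗ[ℝ] (Perm (Fin K) → ℝ) :=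
  (Pi.basisFun ℝ (Perm (Fin (K + 1)))).constr ℝ
    fun π => Pi.single (window K π 1) 1 - Pi.single (window K π 0) 1

theorem boundary_single {K : ℕ} (π : Perm (Fin (K + 1))) :
    boundary K (Pi.single π 1) = Pi.single (window K π 1) 1 - Pi.single (window K π 0) 1 := by
  rw [← Pi.basisFun_apply ℝ, boundary, Module.Basis.constr_basis]

/-- The windows of `σ` form a walk in the overlap graph, so the boundary of the window count
telescopes. -/
theorem boundary_windowCount {K m : ℕ} (σ : Perm (Fin m)) :
    boundary K (windowCount K σ) =
      Pi.single (window K σ (m - K)) 1 - Pi.single (window K σ 0) 1 := by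
  rw [windowCount, map_sum,
    ← Finset.sum_range_sub fun i => (Pi.single (window K σ i) 1 : Perm (Fin K) → ℝ)]
  exact Finset.sum_congr rfl fun i _ => by
    rw [boundary_single, window_window σ i (by omega), window_window σ i (by omega), add_zero]

/-- The space of vectors supported on the permutations of size `k` that avoid `B`. -/
def avoiderSpan (B : Set AnyPerm) (k : ℕ) : Submodule ℝ (Perm (Fin k) → ℝ) :=
  Submodule.span ℝ ((fun π => Pi.single π 1) '' Av B k)

theorem single_mem_avoiderSpan {B : Set AnyPerm} {k : ℕ} {π : Perm (Fin k)} (hπ : π ∈ Av B k) :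
    Pi.single π 1 ∈ avoiderSpan B k :=
  Submodule.subset_span ⟨π, hπ, rfl⟩

theorem finrank_avoiderSpan (B : Set AnyPerm) (k : ℕ) :
    Module.finrank ℝ (avoiderSpan B k) = (Av B k).ncard := by
  classical
  have hli : LinearIndependent ℝ fun π : Av B k => (Pi.single (π : Perm (Fin k)) 1 :
      Perm (Fin k) → ℝ) := by
    have := (Pi.basisFun ℝ (Perm (Fin k))).linearIndependent.comp
      ((↑) : Av B k → Perm (Fin k)) Subtype.val_injective
    simpa [Function.comp_def] using this
  rw [avoiderSpan, Set.image_eq_range, finrank_span_eq_card hli, ← Nat.card_eq_fintype_card,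
    Nat.card_coe_set_eq]

theorem windowCount_mem_avoiderSpan {B : Set AnyPerm} {K m : ℕ} {σ : Perm (Fin m)}
    (hσ : σ ∈ Av B m) : windowCount K σ ∈ avoiderSpan B (K + 1) :=
  Submodule.sum_mem _ fun i hi => single_mem_avoiderSpan
    (window_mem_Av hσ (by have := Finset.mem_range.1 hi; omega))

/-- The sum of the coordinates, as a linear functional. -/
def coordSum (ι : Type*) [Fintype ι] : (ι → ℝ) →ₗ[ℝ] ℝ := ∑ i, LinearMap.proj i

theorem coordSum_apply {ι : Type*} [Fintype ι] (x : ι → ℝ) : coordSum ι x = ∑ i, x i := by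
  simp [coordSum]

theorem coordSum_single {ι : Type*} [Fintype ι] [DecidableEq ι] (i : ι) :
    coordSum ι (Pi.single i 1) = 1 := by
  simp [coordSum_apply]

/-- A nonempty set on an affine hyperplane that misses the origin has a linear span of one more
dimension than its affine hull. -/
theorem finrank_span_eq_finrank_vectorSpan_add_one {E : Type*} [AddCommGroup E] [Module ℝ E]
    [FiniteDimensional ℝ E] {s : Set E} (hs : s.Nonempty) (φ : E →ₗ[ℝ] ℝ)
    (hφ : ∀ x ∈ s, φ x = 1) :
    Module.finrank ℝ (Submodule.span ℝ s) = Module.finrank ℝ (vectorSpan ℝ s) + 1 := by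
  obtain ⟨p, hp⟩ := hs
  have hker : vectorSpan ℝ s ≤ LinearMap.ker φ := by
    rw [vectorSpan_def, Submodule.span_le]
    rintro _ ⟨x, hx, y, hy, rfl⟩
    simp [hφ x hx, hφ y hy]
  have hp' : p ∉ vectorSpan ℝ s := fun h => by
    have := hker h
    rw [LinearMap.mem_ker, hφ p hp] at this
    exact one_ne_zero this
  have hspan : Submodule.span ℝ s = vectorSpan ℝ s ⊔ Submodule.span ℝ {p} := by
    apply le_antisymm
    · rw [Submodule.span_le]
      intro x hx
      rw [← sub_add_cancel x p]
      exact Submodule.add_mem_sup (vsub_mem_vectorSpan ℝ hx hp)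
        (Submodule.mem_span_singleton_self p)
    · refine sup_le ?_ (Submodule.span_mono (Set.singleton_subset_iff.2 hp))
      rw [vectorSpan_def, Submodule.span_le]
      rintro _ ⟨x, hx, y, hy, rfl⟩
      exact Submodule.sub_mem _ (Submodule.subset_span hx) (Submodule.subset_span hy)
  rw [hspan, Submodule.finrank_sup_span_singleton hp']

/-- The overlap graph on the avoiders of `B` is connected: the windows of `ρ ⊕ ρ'` form a walk
from `ρ` to `ρ'`. So boundaries are all vectors whose coordinates sum to zero. -/
theorem map_boundary_avoiderSpan {B : Set AnyPerm} (hB : DirectSumClosed B) (K : ℕ) :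
    (avoiderSpan B (K + 1)).map (boundary K) =
      vectorSpan ℝ ((fun ρ => (Pi.single ρ 1 : Perm (Fin K) → ℝ)) '' Av B K) := by
  apply le_antisymm
  · rw [avoiderSpan, Submodule.map_span, Submodule.span_le]
    rintro _ ⟨_, ⟨π, hπ, rfl⟩, rfl⟩
    change boundary K (Pi.single π 1) ∈ _
    rw [boundary_single]
    exact vsub_mem_vectorSpan ℝ ⟨_, window_mem_Av hπ (by omega), rfl⟩
      ⟨_, window_mem_Av hπ (by omega), rfl⟩
  · rw [vectorSpan_def, Submodule.span_le]
    rintro _ ⟨_, ⟨ρ, hρ, rfl⟩, _, ⟨ρ', hρ', rfl⟩, rfl⟩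
    refine ⟨windowCount K (directSum ρ' ρ), windowCount_mem_avoiderSpan (hB hρ' hρ), ?_⟩
    rw [boundary_windowCount, Nat.add_sub_cancel]
    have h := window_directSum_right (k := K) ρ' ρ 0
    rw [add_zero, window_self] at h
    rw [h, window_directSum_left ρ' ρ (by omega), window_self]
    rfl

theorem finrank_circulations {B : Set AnyPerm} (hB : DirectSumClosed B) {K : ℕ}
    (hne : (Av B K).Nonempty) :
    Module.finrank ℝ (avoiderSpan B (K + 1) ⊓ LinearMap.ker (boundary K) :
        Submodule ℝ (Perm (Fin (K + 1)) → ℝ)) + (Av B K).ncard =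
      (Av B (K + 1)).ncard + 1 := by
  have h1 := LinearMap.finrank_range_add_finrank_ker
    ((boundary K).domRestrict (avoiderSpan B (K + 1)))
  have h2 : LinearMap.range ((boundary K).domRestrict (avoiderSpan B (K + 1))) =
      vectorSpan ℝ ((fun ρ => (Pi.single ρ 1 : Perm (Fin K) → ℝ)) '' Av B K) := by
    rw [← map_boundary_avoiderSpan hB, LinearMap.range_domRestrict]
  have h3 : Module.finrank ℝ
      (LinearMap.ker ((boundary K).domRestrict (avoiderSpan B (K + 1)))) =
      Module.finrank ℝ (avoiderSpan B (K + 1) ⊓ LinearMap.ker (boundary K) :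
        Submodule ℝ (Perm (Fin (K + 1)) → ℝ)) := by
    rw [LinearMap.ker_domRestrict, ← Submodule.finrank_map_subtype_eq, Submodule.map_comap_subtype]
  have h4 := finrank_span_eq_finrank_vectorSpan_add_one
    (hne.image fun ρ => (Pi.single ρ 1 : Perm (Fin K) → ℝ)) (coordSum _)
    (by rintro _ ⟨ρ, -, rfl⟩; exact coordSum_single ρ)
  rw [← avoiderSpan, finrank_avoiderSpan] at h4
  rw [h2, h3, finrank_avoiderSpan] at h1
  omega

/-! ### The span of the feasible region -/

theorem coordSum_of_mem_feasibleRegion {B : Set AnyPerm} {K : ℕ} {v : Perm (Fin (K + 1)) → ℝ}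
    (hv : v ∈ feasibleRegion (K + 1) B) : coordSum _ v = 1 := by
  obtain ⟨σ, hσ, hσK, hsize, hlim⟩ := mem_feasibleRegion_iff.1 hv
  have h1 := ((coordSum (Perm (Fin (K + 1)))).continuous_of_finiteDimensional.tendsto v).comp hlim
  have hinv : Tendsto (fun m => ((σ m).1 : ℝ)⁻¹) atTop (𝓝 0) :=
    tendsto_inv_atTop_zero.comp (tendsto_natCast_atTop_atTop.comp hsize)
  have h2 : Tendsto (fun m => 1 - ((σ m).1 : ℝ)⁻¹ * K) atTop (𝓝 1) := by
    simpa using (hinv.mul_const (K : ℝ)).const_sub 1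
  refine tendsto_nhds_unique h1 (h2.congr fun m => ?_)
  have hpos : ((σ m).1 : ℝ) ≠ 0 := by exact_mod_cast (Nat.one_le_iff_ne_zero.1 (hσ m).1)
  rw [Function.comp_apply, density, map_smul, coordSum_apply, sum_windowCount,
    Nat.cast_sub (hσK m), smul_eq_mul, mul_sub, inv_mul_cancel₀ hpos]

/-- Feasible vectors are circulations on the overlap graph, because the boundary of the walk traced
by a permutation is bounded, independently of its size. -/
theorem feasibleRegion_subset_circulations (B : Set AnyPerm) (K : ℕ) :
    feasibleRegion (K + 1) B ⊆
      (avoiderSpan B (K + 1) ⊓ LinearMap.ker (boundary K) :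
        Submodule ℝ (Perm (Fin (K + 1)) → ℝ)) := by
  intro v hv
  obtain ⟨σ, hσ, hσK, hsize, hlim⟩ := mem_feasibleRegion_iff.1 hv
  refine ⟨(Submodule.closed_of_finiteDimensional (avoiderSpan B (K + 1))).mem_of_tendsto hlim
    (Eventually.of_forall fun m => Submodule.smul_mem _ _ (windowCount_mem_avoiderSpan (hσ m).2)),
    ?_⟩
  have h1 := ((boundary K).continuous_of_finiteDimensional.tendsto v).comp hlim
  have hinv : Tendsto (fun m => ((σ m).1 : ℝ)⁻¹ * 2) atTop (𝓝 0) := by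
    simpa using (tendsto_inv_atTop_zero.comp
      (tendsto_natCast_atTop_atTop.comp hsize)).mul_const (2 : ℝ)
  refine tendsto_nhds_unique h1 (squeeze_zero_norm (fun m => ?_) hinv)
  rw [Function.comp_apply, density, map_smul, boundary_windowCount, norm_smul, norm_inv,
    Real.norm_natCast]
  refine mul_le_mul_of_nonneg_left ((norm_sub_le _ _).trans ?_) (by positivity)
  rw [Pi.norm_single, Pi.norm_single, norm_one]
  norm_num

theorem windowCount_add_junctionCount_mem_span {B : Set AnyPerm} (hB : DirectSumClosed B)
    {K m : ℕ} {σ : Perm (Fin m)} (hσ : σ ∈ Av B m) (hK : K ≤ m) :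
    windowCount K σ + junctionCount K σ σ ∈ Submodule.span ℝ (feasibleRegion (K + 1) B) := by
  rcases Nat.eq_zero_or_pos m with rfl | hm
  · -- the empty permutation has no windows, and neither has its direct sum with itself
    rw [Nat.le_zero] at hK
    subst hK
    rw [junctionCount, windowCount_of_le _ le_rfl, windowCount_of_le _ le_rfl, add_zero]
    exact Submodule.zero_mem _
  · have h := periodic_mem_feasibleRegion hB (σ := ⟨m, σ⟩) ⟨hm, hσ⟩ hK
    have hm' : (m : ℝ) ≠ 0 := by exact_mod_cast hm.ne'
    have h2 := Submodule.smul_mem _ (m : ℝ) (Submodule.subset_span (R := ℝ) h)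
    rwa [smul_inv_smul₀ hm'] at h2

/-- Modulo the span of the feasible region, junction counts form an additive cocycle. -/
theorem junctionCount_cocycle {B : Set AnyPerm} (hB : DirectSumClosed B) {K : ℕ}
    {ρ₁ ρ₂ ρ₃ : Perm (Fin K)} (h₁ : ρ₁ ∈ Av B K) (h₂ : ρ₂ ∈ Av B K) (h₃ : ρ₃ ∈ Av B K) :
    junctionCount K ρ₁ ρ₂ + junctionCount K ρ₂ ρ₃ + junctionCount K ρ₃ ρ₁ ∈
      Submodule.span ℝ (feasibleRegion (K + 1) B) := by
  have h := windowCount_add_junctionCount_mem_span hB (hB (hB h₁ h₂) h₃) (K := K) (by omega)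
  rwa [windowCount_directSum _ _ (by omega) le_rfl, windowCount_directSum _ _ le_rfl le_rfl,
    windowCount_of_le _ le_rfl, windowCount_of_le _ le_rfl, windowCount_of_le _ le_rfl, zero_add,
    zero_add, add_zero, junctionCount_directSum_left _ _ _ le_rfl,
    junctionCount_directSum_left _ _ _ le_rfl, junctionCount_directSum_right _ _ _ (by omega),
    junctionCount_directSum_right _ _ _ le_rfl] at h

/-- The unit vector of a pattern is congruent to the difference of the potentials
`ρ ↦ junctionCount K ρ ρ₀` at the two ends of its edge. -/
theorem single_congr_junctionCount {B : Set AnyPerm} (hB : DirectSumClosed B) {K : ℕ}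
    {ρ₀ : Perm (Fin K)} (h₀ : ρ₀ ∈ Av B K) {π : Perm (Fin (K + 1))} (hπ : π ∈ Av B (K + 1)) :
    Pi.single π 1 + (junctionCount K (window K π 1) ρ₀ - junctionCount K (window K π 0) ρ₀) ∈
      Submodule.span ℝ (feasibleRegion (K + 1) B) := by
  have hend : window K π 1 ∈ Av B K := window_mem_Av hπ (by omega)
  have hbeg : window K π 0 ∈ Av B K := window_mem_Av hπ (by omega)
  have h1 := windowCount_add_junctionCount_mem_span hB hπ (K := K) (by omega)
  have hj : junctionCount K π π = junctionCount K (window K π 1) (window K π 0) := by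
    rw [junctionCount_of_size, junctionCount, Nat.add_sub_cancel_left]
  rw [windowCount_self, hj] at h1
  have h2 := junctionCount_cocycle hB hend hbeg h₀
  have h3 := junctionCount_cocycle hB h₀ h₀ h₀
  have h4 := junctionCount_cocycle hB h₀ hend h₀
  -- `h3` is three times `c(ρ₀, ρ₀)`, which remains from `h4` after the other terms cancel
  have h5 := Submodule.sub_mem _ (Submodule.add_mem _ (Submodule.sub_mem _ h1 h2) h4)
    (Submodule.smul_mem _ (3⁻¹ : ℝ) h3)
  convert h5 using 1
  module

theorem circulations_le_span_feasibleRegion {B : Set AnyPerm} (hB : DirectSumClosed B) {K : ℕ}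
    (hne : (Av B K).Nonempty) :
    avoiderSpan B (K + 1) ⊓ LinearMap.ker (boundary K) ≤
      Submodule.span ℝ (feasibleRegion (K + 1) B) := by
  obtain ⟨ρ₀, h₀⟩ := hne
  let G : (Perm (Fin K) → ℝ) →ₗ[ℝ] (Perm (Fin (K + 1)) → ℝ) :=
    (Pi.basisFun ℝ (Perm (Fin K))).constr ℝ fun ρ => junctionCount K ρ ρ₀
  have hG : ∀ ρ, G (Pi.single ρ 1) = junctionCount K ρ ρ₀ := fun ρ => by
    rw [← Pi.basisFun_apply ℝ, Module.Basis.constr_basis]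
  have key : avoiderSpan B (K + 1) ≤ (Submodule.span ℝ (feasibleRegion (K + 1) B)).comap
      (LinearMap.id + G ∘ₗ boundary K) := by
    rw [avoiderSpan, Submodule.span_le]
    rintro _ ⟨π, hπ, rfl⟩
    have h := single_congr_junctionCount hB h₀ hπ
    rw [← hG, ← hG, ← map_sub, ← boundary_single] at h
    exact h
  rintro x ⟨hx, hker⟩
  have h := key hx
  rw [Submodule.mem_comap, LinearMap.add_apply, LinearMap.comp_apply, LinearMap.mem_ker.1 hker,
    map_zero, add_zero] at h
  exact h

theorem span_feasibleRegion {B : Set AnyPerm} (hB : DirectSumClosed B) {K : ℕ}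
    (hne : (Av B K).Nonempty) :
    Submodule.span ℝ (feasibleRegion (K + 1) B) =
      avoiderSpan B (K + 1) ⊓ LinearMap.ker (boundary K) :=
  le_antisymm (Submodule.span_le.2 (feasibleRegion_subset_circulations B K))
    (circulations_le_span_feasibleRegion hB hne)

end ConsecutivePatterns

theorem theorem1p10 (n k : ℕ) (hn : 2 ≤ n) (hk : 1 ≤ k) :
    (ConsecutivePatterns.feasibleRegion k {ConsecutivePatterns.decreasing n}).Nonempty ∧
    Convex ℝ (ConsecutivePatterns.feasibleRegion k {ConsecutivePatterns.decreasing n}) ∧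
    (Module.finrank ℝ
        (vectorSpan ℝ
          (ConsecutivePatterns.feasibleRegion k {ConsecutivePatterns.decreasing n})) : ℤ) =
      ((ConsecutivePatterns.Av {ConsecutivePatterns.decreasing n} k).ncard : ℤ) -
        ((ConsecutivePatterns.Av {ConsecutivePatterns.decreasing n} (k - 1)).ncard : ℤ) := by
  open ConsecutivePatterns in
  obtain ⟨K, rfl⟩ := Nat.exists_eq_add_of_le' hk
  have hB := directSumClosed_decreasing hn
  have hne : (Av {decreasing n} K).Nonempty := ⟨1, one_mem_Av_decreasing hn K⟩
  have hregion : (feasibleRegion (K + 1) {decreasing n}).Nonempty :=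
    ⟨_, periodic_mem_feasibleRegion hB (σ := ⟨K + 1, 1⟩)
      ⟨Nat.le_add_left 1 K, one_mem_Av_decreasing hn (K + 1)⟩ (Nat.le_succ K)⟩
  refine ⟨hregion, convex_feasibleRegion hB, ?_⟩
  have h1 := finrank_span_eq_finrank_vectorSpan_add_one hregion (coordSum _)
    fun v hv => coordSum_of_mem_feasibleRegion hv
  have h2 := finrank_circulations hB hne
  rw [← span_feasibleRegion hB hne, h1] at h2
  rw [Nat.add_sub_cancel]
  omega
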